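/- Let $n\in\{1,2,3\}$, let $\Omega\subset\mathbb{R}^n$ be a bounded convex domain with smooth boundary and outer unit normal $\nu$, and let $0<c$, $0<C$. Then there are constants $C_1,C_2,C_3>0$, depending only on $n,\Omega,c,C$, such that the following holds. Let $\alpha>1$, let $d,\phi,\rho_0\in C^2(\overline\Omega)$ with $d\ge D_{\min}$ on $\overline\Omega$ for some constant $D_{\min}>0$, $\rho_0>0$ on $\overline\Omega$ and $\int_\Omega\rho_0\,dx=1$, and let $\rho$ be a positive classical solution on $\overline\Omega\times[0,\infty)$ of $$\begin{cases}\partial_t\rho-\operatorname{div}\bigl(\rho\nabla(\alpha\, d(x)\rho^{\alpha-1}+\phi(x))\bigr)=0, & x\in\Omega,\ t>0,\\ \rho(x,0)=\rho_0(x), & x\in\overline\Omega,\\ \rho\nabla(\alpha\, d(x)\rho^{\alpha-1}+\phi(x))\cdot\nu=0, & x\in\partial\Omega,\ t>0,\end{cases}$$ that is, $\rho$ is continuous on $\overline\Omega\times[0,\infty)$, the derivatives $\partial_t\rho$, $\nabla\rho$, $\nabla^2\rho$ exist and are continuous on $\overline\Omega\times(0,\infty)$, and the equations hold pointwise. Suppose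 that $c\le\rho(x,t)\le C$ for all $x\in\overline\Omega$ and $t>0$. Then for every $t\ge0$ and every vector field $v\in C^1(\Omega;\mathbb{R}^n)$, with $\rho=\rho(\cdot,t)$, $$\int_\Omega|v|^3\rho\,dx\le C_1\int_\Omega|\nabla v|^2\rho\,dx+C_2\Bigl(\int_\Omega|v|^2\rho\,dx\Bigr)^{3}+C_3\Bigl(\int_\Omega|v|^2\rho\,dx\Bigr)^{3/2}.$$ Here $|v|$ is the Euclidean norm, $|\nabla v|^2=\sum_{i,j}(\partial_jv_i)^2$, and the integrals take values in $[0,\infty]$ (so the left-hand side is finite whenever the right-hand side is). -/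

import Mathlib

open Set MeasureTheory

open scoped ENNReal ContDiff

noncomputable section

/-- `g` is a smooth local defining function on `U` for the open set `Ω` near `p`: its gradient
vanishes nowhere on `U`, and `Ω` coincides with `{g < 0}` inside `U`. -/
structure IsLocalDefiningFunction {n : ℕ} (Ω : Set (EuclideanSpace ℝ (Fin n)))
    (p : EuclideanSpace ℝ (Fin n)) (U : Set (EuclideanSpace ℝ (Fin n)))
    (g : EuclideanSpace ℝ (Fin n) → ℝ) : Prop where
  isOpen : IsOpen U
  mem : p ∈ U
  contDiffOn : ContDiffOn ℝ ∞ g U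
  gradient_ne_zero : ∀ x ∈ U, gradient g x ≠ 0
  inter_eq : Ω ∩ U = {x ∈ U | g x < 0}

/-- The boundary of `Ω` is smooth, with `Ω` lying locally on one side of it. -/
def HasSmoothBoundary {n : ℕ} (Ω : Set (EuclideanSpace ℝ (Fin n))) : Prop :=
  ∀ p ∈ frontier Ω, ∃ U g, IsLocalDefiningFunction Ω p U g

/-- `ν` is the outer unit normal vector of `Ω` at the boundary point `p`, that is
`∇g(p) / |∇g(p)|` for a local defining function `g`. -/
def IsOuterUnitNormal {n : ℕ} (Ω : Set (EuclideanSpace ℝ (Fin n)))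
    (p ν : EuclideanSpace ℝ (Fin n)) : Prop :=
  p ∈ frontier Ω ∧
    ∃ U g, IsLocalDefiningFunction Ω p U g ∧ ν = ‖gradient g p‖⁻¹ • gradient g p

/-- A bounded convex domain with smooth boundary. -/
structure IsSmoothBoundedConvexDomain {n : ℕ} (Ω : Set (EuclideanSpace ℝ (Fin n))) : Prop where
  isOpen : IsOpen Ω
  nonempty : Ω.Nonempty
  isBounded : Bornology.IsBounded Ω
  convex : Convex ℝ Ω
  smooth_boundary : HasSmoothBoundary Ω

/-- The divergence `∑ᵢ ∂ᵢ Fᵢ` of a vector field. -/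
def divergence {n : ℕ} (F : EuclideanSpace ℝ (Fin n) → EuclideanSpace ℝ (Fin n))
    (x : EuclideanSpace ℝ (Fin n)) : ℝ :=
  ∑ i, (fderiv ℝ F x (EuclideanSpace.single i 1)) i

/-- The squared Euclidean norm `|∇v|² = ∑ᵢⱼ (∂ⱼ vᵢ)²` of the Jacobian matrix of `v`. -/
def gradNormSq {n : ℕ} (v : EuclideanSpace ℝ (Fin n) → EuclideanSpace ℝ (Fin n))
    (x : EuclideanSpace ℝ (Fin n)) : ℝ :=
  ∑ i, ∑ j, ((fderiv ℝ v x (EuclideanSpace.single j 1)) i) ^ 2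

/-- The potential `μ = α d(x) ρ^(α-1) + φ(x)`. -/
def nfpPotential {n : ℕ} (α : ℝ) (d φ r : EuclideanSpace ℝ (Fin n) → ℝ)
    (x : EuclideanSpace ℝ (Fin n)) : ℝ :=
  α * d x * r x ^ (α - 1) + φ x

/-- The flux `ρ ∇μ` on the closure of `Ω`; at boundary points `∇` is the derivative within
the closure, which at points of the open set `Ω` is the usual one. -/
def nfpFlux {n : ℕ} (Ω : Set (EuclideanSpace ℝ (Fin n))) (α : ℝ)
    (d φ r : EuclideanSpace ℝ (Fin n) → ℝ) (x : EuclideanSpace ℝ (Fin n)) :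
    EuclideanSpace ℝ (Fin n) :=
  r x • gradientWithin (nfpPotential α d φ r) (closure Ω) x

/-- Admissible data of the problem: `α > 1`; `d`, `φ`, `ρ₀` are `C²` on the closure of `Ω`;
`d ≥ Dmin > 0`; and `ρ₀` is a positive probability density. -/
structure IsNFPData {n : ℕ} (Ω : Set (EuclideanSpace ℝ (Fin n))) (α Dmin : ℝ)
    (d φ ρ₀ : EuclideanSpace ℝ (Fin n) → ℝ) : Prop where
  one_lt : 1 < α
  contDiffOn_d : ContDiffOn ℝ 2 d (closure Ω)
  contDiffOn_φ : ContDiffOn ℝ 2 φ (closure Ω)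
  contDiffOn_ρ₀ : ContDiffOn ℝ 2 ρ₀ (closure Ω)
  Dmin_pos : 0 < Dmin
  Dmin_le : ∀ x ∈ closure Ω, Dmin ≤ d x
  ρ₀_pos : ∀ x ∈ closure Ω, 0 < ρ₀ x
  integral_ρ₀ : ∫ x in Ω, ρ₀ x = 1

/-- `ρ` (as a function of time and space) is a positive global-in-time classical solution on
`closure Ω × [0, ∞)` of `∂ρ/∂t = div (ρ ∇(α d ρ^(α-1) + φ))` with the no-flux boundary condition
and initial value `ρ₀`. It is continuous up to `t = 0`; for `t > 0` it is `C²` in space up to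
the boundary and `C¹` in time, with all these derivatives jointly continuous. -/
structure IsClassicalSolution {n : ℕ} (Ω : Set (EuclideanSpace ℝ (Fin n))) (α : ℝ)
    (d φ ρ₀ : EuclideanSpace ℝ (Fin n) → ℝ) (ρ : ℝ → EuclideanSpace ℝ (Fin n) → ℝ) : Prop where
  pos : ∀ t, 0 ≤ t → ∀ x ∈ closure Ω, 0 < ρ t x
  continuousOn :
    ContinuousOn (fun q : ℝ × EuclideanSpace ℝ (Fin n) => ρ q.1 q.2) (Ici 0 ×ˢ closure Ω)
  contDiffOn_space : ∀ t, 0 < t → ContDiffOn ℝ 2 (ρ t) (closure Ω)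
  continuousOn_space_deriv : ∀ k : ℕ, k ≤ 2 →
    ContinuousOn (fun q : ℝ × EuclideanSpace ℝ (Fin n) =>
      iteratedFDerivWithin ℝ k (ρ q.1) (closure Ω) q.2) (Ioi 0 ×ˢ closure Ω)
  differentiableAt_time : ∀ t, 0 < t → ∀ x ∈ closure Ω, DifferentiableAt ℝ (fun s => ρ s x) t
  continuousOn_time_deriv :
    ContinuousOn (fun q : ℝ × EuclideanSpace ℝ (Fin n) => deriv (fun s => ρ s q.2) q.1)
      (Ioi 0 ×ˢ closure Ω)
  equation : ∀ t, 0 < t → ∀ x ∈ Ω,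
    deriv (fun s => ρ s x) t - divergence (nfpFlux Ω α d φ (ρ t)) x = 0
  no_flux : ∀ t, 0 < t → ∀ p ∈ frontier Ω, ∀ ν, IsOuterUnitNormal Ω p ν →
    inner ℝ (nfpFlux Ω α d φ (ρ t) p) ν = 0
  initial : ∀ x ∈ closure Ω, ρ 0 x = ρ₀ x

end

/-!
The inequality is a Gagliardo–Nirenberg interpolation between `L²` and `H¹`. Since `c ≤ ρ ≤ C`
(also at `t = 0`, by continuity), the weight can be dropped at the cost of constants, and the
equation satisfied by `ρ` plays no further role.

The exponent `3` is below the Sobolev exponent, so no Sobolev embedding is needed: averaging over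
contracted copies of the convex set `Ω` suffices. For `x, y ∈ Ω` the fundamental theorem of calculus
along `τ ↦ (1 - τ²) x + τ² y`, `0 ≤ τ ≤ l`, gives, with `D = diam Ω`,
`|v(x)| ≤ |v((1 - l²) x + l² y)| + 2 D ∫₀ˡ τ |∇v|((1 - τ²) x + τ² y) dτ`.
Averaging over `y ∈ Ω` replaces the functions on the right by their means `T` over
`(1 - τ²) x + τ² Ω` (`contractionMean`). The operator `T` maps `L²` to `L²` with bounded norm and
`L²` to `L^∞` with norm of order `τ⁻ⁿ`, hence, for `n ≤ 3`, the integral of `(T g)³` is at most of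
order `τ⁻³ ‖g‖₂³` (`lintegral_contractionMean_pow_three_le`). Hölder's inequality in `τ` then yields
`‖v‖₃³ ≤ K (l⁻³ ‖v‖₂³ + (2 D)³ l³ ‖∇v‖₂³)` for `0 < l ≤ 1/2` (`lintegral_enorm_pow_three_le`).
With `F = ‖∇v‖₂²`, the choice `l = F^(-1/6) / 2` if `F ≥ 1`, and `l = 1/2` otherwise, gives the claim
(`le_of_forall_scale`).
-/

/-! ### Averages over contracted copies of a set -/

section ContractionMean

variable {E : Type*} [NormedAddCommGroup E] [NormedSpace ℝ E] [MeasurableSpace E] [BorelSpace E]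

/-- Jensen's inequality for integer powers and a measure that need not be normalized. -/
theorem pow_lintegral_le {α : Type*} [MeasurableSpace α] (μ : Measure α) {f : α → ℝ≥0∞}
    (hf : AEMeasurable f μ) {k : ℕ} (hk : k ≠ 0) :
    (∫⁻ a, f a ∂μ) ^ (k + 1) ≤ μ univ ^ k * ∫⁻ a, f a ^ (k + 1) ∂μ := by
  have hk0 : (0 : ℝ) < k := by positivity
  have hpq : ((k : ℝ) + 1).HolderConjugate (((k : ℝ) + 1) / k) := by
    rw [Real.holderConjugate_iff]
    constructor
    · linarith
    · field_simp
      exact add_comm _ _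
  have h := ENNReal.lintegral_mul_le_Lp_mul_Lq μ hpq hf (aemeasurable_const (b := (1 : ℝ≥0∞)))
  simp only [Pi.mul_apply, mul_one, ENNReal.one_rpow, lintegral_one] at h
  refine (pow_le_pow_left' h (k + 1)).trans_eq ?_
  rw [mul_pow, ← ENNReal.rpow_natCast, ← ENNReal.rpow_natCast (_ ^ _), ← ENNReal.rpow_mul,
    ← ENNReal.rpow_mul, mul_comm]
  have e1 : 1 / ((k : ℝ) + 1) * ((k + 1 : ℕ) : ℝ) = 1 := by push_cast; field_simp
  have e2 : 1 / (((k : ℝ) + 1) / k) * ((k + 1 : ℕ) : ℝ) = k := by push_cast; field_simp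
  rw [e1, e2, ENNReal.rpow_one, ENNReal.rpow_natCast]
  congr 2
  ext a
  rw [← ENNReal.rpow_natCast]
  push_cast
  rfl

/-- The mean of `g` over the image of `S` under the contraction `y ↦ (1 - σ) x + σ y` towards `x`,
written as an integral over `S`. -/
noncomputable def contractionMean (μ : Measure E) (S : Set E) (σ : ℝ) (g : E → ℝ≥0∞)
    (x : E) : ℝ≥0∞ :=
  (μ S)⁻¹ * ∫⁻ y in S, g ((1 - σ) • x + σ • y) ∂μ

variable (μ : Measure E) {S : Set E} {g : E → ℝ≥0∞}

theorem sq_contractionMean_le (h0 : μ S ≠ 0) (h1 : μ S ≠ ⊤) (hg : Measurable g) (σ : ℝ) (x : E) :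
    contractionMean μ S σ g x ^ 2 ≤ contractionMean μ S σ (fun y => g y ^ 2) x := by
  unfold contractionMean
  have h := pow_lintegral_le (μ.restrict S) (f := fun y => g ((1 - σ) • x + σ • y))
    (by fun_prop) one_ne_zero
  rw [Measure.restrict_apply_univ, pow_one, one_add_one_eq_two] at h
  calc _ = (μ S)⁻¹ ^ 2 * (∫⁻ y in S, g ((1 - σ) • x + σ • y) ∂μ) ^ 2 := mul_pow _ _ _
    _ ≤ (μ S)⁻¹ ^ 2 * (μ S * ∫⁻ y in S, g ((1 - σ) • x + σ • y) ^ 2 ∂μ) := by gcongr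
    _ = (μ S)⁻¹ * ((μ S)⁻¹ * μ S) * ∫⁻ y in S, g ((1 - σ) • x + σ • y) ^ 2 ∂μ := by ring
    _ = _ := by rw [ENNReal.inv_mul_cancel h0 h1, mul_one]

variable [FiniteDimensional ℝ E] [μ.IsAddHaarMeasure]

theorem lintegral_comp_add_smul {f : E → ℝ≥0∞}
    (hf : Measurable f) (a : E) {r : ℝ} (hr : 0 < r) :
    ∫⁻ x, f (a + r • x) ∂μ =
      ENNReal.ofReal ((r ^ Module.finrank ℝ E)⁻¹) * ∫⁻ x, f x ∂μ := by
  have h := lintegral_map (μ := μ) (f := fun x => f (a + x)) (g := fun x => r • x)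
    (by fun_prop) (by fun_prop)
  rw [← h, Measure.map_addHaar_smul μ hr.ne', lintegral_smul_measure, lintegral_add_left_eq_self,
    abs_of_pos (by positivity), smul_eq_mul]

theorem measurable_contractionMean (hg : Measurable g) :
    Measurable fun q : ℝ × E => contractionMean μ S q.1 g q.2 := by
  unfold contractionMean
  refine Measurable.const_mul ?_ _
  refine Measurable.lintegral_prod_right' (ν := μ.restrict S)
    (f := fun q : (ℝ × E) × E => g ((1 - q.1.1) • q.1.2 + q.1.1 • q.2)) ?_
  fun_prop

/-- The `L¹ → L^∞` bound: the contracted copy of `S` has volume `σ ^ dim E` times that of `S`. -/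
theorem contractionMean_le (hg : Measurable g) {σ : ℝ} (hσ : 0 < σ) (x : E) :
    contractionMean μ S σ g x ≤
      (μ S)⁻¹ * (ENNReal.ofReal ((σ ^ Module.finrank ℝ E)⁻¹) * ∫⁻ y, g y ∂μ) := by
  rw [← lintegral_comp_add_smul μ hg ((1 - σ) • x) hσ]
  exact mul_le_mul_right (setLIntegral_le_lintegral _ _) _

/-- The `L¹ → L¹` bound: for fixed `y`, the map `x ↦ (1 - σ) x + σ y` changes volumes by the factor
`(1 - σ) ^ dim E`. -/
theorem lintegral_contractionMean_le (h0 : μ S ≠ 0) (h1 : μ S ≠ ⊤) (hg : Measurable g) {σ : ℝ}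
    (hσ : σ < 1) :
    ∫⁻ x, contractionMean μ S σ g x ∂μ ≤
      ENNReal.ofReal (((1 - σ) ^ Module.finrank ℝ E)⁻¹) * ∫⁻ y, g y ∂μ := by
  unfold contractionMean
  rw [lintegral_const_mul' _ _ (ENNReal.inv_ne_top.2 h0), lintegral_lintegral_swap (by fun_prop)]
  have h : ∀ y : E, ∫⁻ x, g ((1 - σ) • x + σ • y) ∂μ =
      ENNReal.ofReal (((1 - σ) ^ Module.finrank ℝ E)⁻¹) * ∫⁻ y, g y ∂μ := fun y => by
    rw [← lintegral_comp_add_smul μ hg (σ • y) (sub_pos.2 hσ)]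
    simp_rw [add_comm]
  simp_rw [h]
  rw [setLIntegral_const, mul_comm _ (μ S), ← mul_assoc, ENNReal.inv_mul_cancel h0 h1, one_mul]

/-- The `L² → L³` bound for the contraction mean with parameter `τ²`, obtained by interpolating
between the `L² → L^∞` and the `L² → L²` bounds. In dimension at most three it grows like `τ⁻¹`
(that is, `τ⁻³` for the cube), which `2 τ dτ` compensates. -/
theorem lintegral_contractionMean_pow_three_le (hE : Module.finrank ℝ E ≤ 3)
    (h0 : μ S ≠ 0) (h1 : μ S ≠ ⊤) (hg : Measurable g) {τ : ℝ} (hτ : 0 < τ) (hτ' : τ ≤ 1 / 2) :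
    ∫⁻ x, contractionMean μ S (τ ^ 2) g x ^ 3 ∂μ ≤
      8 * (μ S)⁻¹ ^ (1 / 2 : ℝ) * ENNReal.ofReal ((τ ^ 3)⁻¹) *
        (∫⁻ x, g x ^ 2 ∂μ) ^ (3 / 2 : ℝ) := by
  set I := ∫⁻ x, g x ^ 2 ∂μ with hI
  set N := Module.finrank ℝ E
  have hg2 : Measurable fun y => g y ^ 2 := by fun_prop
  have hsq : τ ^ 2 ≤ 1 / 2 := by nlinarith
  have hsup : ∀ x, contractionMean μ S (τ ^ 2) g x ≤
      (μ S)⁻¹ ^ (1 / 2 : ℝ) * ENNReal.ofReal ((τ ^ 3)⁻¹) * I ^ (1 / 2 : ℝ) := by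
    intro x
    -- the dimension enters here: `τ ^ (2 * N)` is at least `τ ^ 6`
    have hb : ENNReal.ofReal (((τ ^ 2) ^ N)⁻¹) ≤ ENNReal.ofReal ((τ ^ 3)⁻¹) ^ (2 : ℝ) := by
      rw [ENNReal.ofReal_rpow_of_nonneg (by positivity) (by norm_num)]
      apply ENNReal.ofReal_le_ofReal
      rw [Real.rpow_two, inv_pow, ← pow_mul, ← pow_mul, mul_comm 3 2]
      refine inv_anti₀ (by positivity) ?_
      exact pow_le_pow_of_le_one hτ.le (by linarith) (by omega)
    have h := ((sq_contractionMean_le μ h0 h1 hg (τ ^ 2) x).trans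
      (contractionMean_le μ hg2 (by positivity) x))
    rw [← ENNReal.rpow_two] at h
    calc _ = (contractionMean μ S (τ ^ 2) g x ^ (2 : ℝ)) ^ (1 / 2 : ℝ) := by
          rw [← ENNReal.rpow_mul]; norm_num
      _ ≤ ((μ S)⁻¹ * (ENNReal.ofReal ((τ ^ 3)⁻¹) ^ (2 : ℝ) * I)) ^ (1 / 2 : ℝ) := by
          gcongr
          exact h.trans (by gcongr)
      _ = _ := by
          rw [ENNReal.mul_rpow_of_nonneg _ _ (by norm_num),
            ENNReal.mul_rpow_of_nonneg _ _ (by norm_num), ← ENNReal.rpow_mul, ← mul_assoc]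
          norm_num
  have hint : ∫⁻ x, contractionMean μ S (τ ^ 2) (fun y => g y ^ 2) x ∂μ ≤ 8 * I := by
    refine (lintegral_contractionMean_le μ h0 h1 hg2 (by linarith)).trans ?_
    gcongr
    -- `1 - τ ^ 2 ≥ 1 / 2`, so the factor is at most `2 ^ 3`
    rw [show (8 : ℝ≥0∞) = ENNReal.ofReal 8 by norm_num]
    apply ENNReal.ofReal_le_ofReal
    rw [← inv_pow]
    calc ((1 - τ ^ 2)⁻¹) ^ N ≤ 2 ^ N := by
          have hpos : 0 ≤ (1 - τ ^ 2)⁻¹ := inv_nonneg.2 (by linarith)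
          gcongr
          rw [inv_le_comm₀ (by linarith) (by norm_num)]
          linarith
      _ ≤ 2 ^ 3 := pow_le_pow_right₀ (by norm_num) hE
      _ = 8 := by norm_num
  calc ∫⁻ x, contractionMean μ S (τ ^ 2) g x ^ 3 ∂μ
      ≤ ∫⁻ x, (μ S)⁻¹ ^ (1 / 2 : ℝ) * ENNReal.ofReal ((τ ^ 3)⁻¹) * I ^ (1 / 2 : ℝ) *
          contractionMean μ S (τ ^ 2) (fun y => g y ^ 2) x ∂μ := by
        refine lintegral_mono fun x => ?_
        rw [pow_succ']
        exact mul_le_mul' (hsup x) (sq_contractionMean_le μ h0 h1 hg _ x)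
    _ = (μ S)⁻¹ ^ (1 / 2 : ℝ) * ENNReal.ofReal ((τ ^ 3)⁻¹) * I ^ (1 / 2 : ℝ) *
          ∫⁻ x, contractionMean μ S (τ ^ 2) (fun y => g y ^ 2) x ∂μ :=
        lintegral_const_mul _
          ((measurable_contractionMean μ hg2).comp (measurable_const.prodMk measurable_id))
    _ ≤ (μ S)⁻¹ ^ (1 / 2 : ℝ) * ENNReal.ofReal ((τ ^ 3)⁻¹) * I ^ (1 / 2 : ℝ) * (8 * I) := by
        gcongr
    _ = 8 * (μ S)⁻¹ ^ (1 / 2 : ℝ) * ENNReal.ofReal ((τ ^ 3)⁻¹) *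
          (I ^ (1 / 2 : ℝ) * I ^ (1 : ℝ)) := by rw [ENNReal.rpow_one]; ring
    _ = _ := by
        rw [← ENNReal.rpow_add_of_nonneg _ _ (by norm_num) (by norm_num)]
        norm_num

end ContractionMean

/-! ### The interpolation inequality on a convex open set -/

section ConvexDomain

variable {E F : Type*} [NormedAddCommGroup E] [NormedSpace ℝ E]
  [NormedAddCommGroup F] [NormedSpace ℝ F] [CompleteSpace F]

/-- The fundamental theorem of calculus along the segment from `x` to `y`, run through with the
quadratic parametrization `τ ↦ (1 - τ²) x + τ² y`. -/
theorem enorm_le_enorm_add_lintegral_fderiv {Ω : Set E} (hΩ : IsOpen Ω) (hconv : Convex ℝ Ω)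
    {v : E → F} (hv : ContDiffOn ℝ 1 v Ω) {x y : E} (hx : x ∈ Ω) (hy : y ∈ Ω) {D : ℝ}
    (hD : ‖y - x‖ ≤ D) {l : ℝ} (hl : 0 ≤ l) (hl' : l ≤ 1) :
    ‖v x‖ₑ ≤ ‖v ((1 - l ^ 2) • x + l ^ 2 • y)‖ₑ + ENNReal.ofReal (2 * D) *
      ∫⁻ τ in Ioc 0 l, ENNReal.ofReal τ * ‖fderiv ℝ v ((1 - τ ^ 2) • x + τ ^ 2 • y)‖ₑ := by
  set γ : ℝ → E := fun τ => (1 - τ ^ 2) • x + τ ^ 2 • y with hγ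
  have hmem : ∀ τ ∈ Icc 0 l, γ τ ∈ Ω := fun τ hτ => by
    have h1 : τ ^ 2 ≤ 1 := pow_le_one₀ hτ.1 (hτ.2.trans hl')
    exact hconv hx hy (by linarith) (by positivity) (by ring)
  have hγd : ∀ τ, HasDerivAt γ ((2 * τ) • (y - x)) τ := fun τ => by
    have h2 : HasDerivAt (fun τ : ℝ => τ ^ 2) (2 * τ) τ := by simpa using hasDerivAt_pow 2 τ
    have h := ((h2.const_sub 1).smul_const x).add (h2.smul_const y)
    convert! h using 1
    module
  have hγc : Continuous γ := by fun_prop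
  have hderiv : ∀ τ ∈ uIcc 0 l,
      HasDerivAt (v ∘ γ) (fderiv ℝ v (γ τ) ((2 * τ) • (y - x))) τ := fun τ hτ => by
    rw [uIcc_of_le hl] at hτ
    have hd : DifferentiableAt ℝ v (γ τ) :=
      (hv.differentiableOn one_ne_zero).differentiableAt (hΩ.mem_nhds (hmem τ hτ))
    exact hd.hasFDerivAt.comp_hasDerivAt τ (hγd τ)
  have hcont : ContinuousOn (fun τ => fderiv ℝ v (γ τ) ((2 * τ) • (y - x))) (uIcc 0 l) := by
    rw [uIcc_of_le hl]
    exact ((hv.continuousOn_fderiv_of_isOpen hΩ le_rfl).comp hγc.continuousOn hmem).clm_apply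
      (by fun_prop)
  have hftc := intervalIntegral.integral_eq_sub_of_hasDerivAt hderiv hcont.intervalIntegrable
  have h0 : γ 0 = x := by simp [hγ]
  rw [Function.comp_apply, Function.comp_apply, h0, intervalIntegral.integral_of_le hl] at hftc
  have hvx : v x = v (γ l) - ∫ τ in Ioc 0 l, fderiv ℝ v (γ τ) ((2 * τ) • (y - x)) := by
    rw [hftc]; abel
  rw [hvx]
  refine enorm_sub_le.trans (add_le_add le_rfl ?_)
  refine (enorm_integral_le_lintegral_enorm _).trans ?_
  rw [← lintegral_const_mul' _ _ ENNReal.ofReal_ne_top]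
  refine setLIntegral_mono_ae' measurableSet_Ioc (Filter.Eventually.of_forall fun τ hτ => ?_)
  have hτ0 : 0 ≤ τ := hτ.1.le
  have hD0 : 0 ≤ D := (norm_nonneg _).trans hD
  simp only [← ofReal_norm]
  rw [← ENNReal.ofReal_mul hτ0, ← ENNReal.ofReal_mul (by positivity)]
  apply ENNReal.ofReal_le_ofReal
  refine (ContinuousLinearMap.le_opNorm _ _).trans ?_
  rw [norm_smul, Real.norm_of_nonneg (by positivity)]
  calc _ ≤ ‖fderiv ℝ v (γ τ)‖ * (2 * τ * D) := by gcongr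
    _ = _ := by ring

variable [FiniteDimensional ℝ E] [MeasurableSpace E] [BorelSpace E]
  (μ : Measure E) [μ.IsAddHaarMeasure]

/-- The average over `y ∈ Ω` of the bounds along the segments from `x` to `y`. The functions `g` and
`h` stand for `‖v‖` and `‖∇v‖` on `Ω`, and for measurable extensions of these elsewhere. -/
theorem enorm_le_contractionMean_add {Ω : Set E} (hΩ : IsOpen Ω) (hconv : Convex ℝ Ω)
    (h0 : μ Ω ≠ 0) (h1 : μ Ω ≠ ⊤)
    {v : E → F} (hv : ContDiffOn ℝ 1 v Ω) {D : ℝ} (hD : ∀ x ∈ Ω, ∀ y ∈ Ω, ‖y - x‖ ≤ D)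
    {g h : E → ℝ≥0∞} (hg : Measurable g) (hh : Measurable h) (hgv : ∀ x ∈ Ω, ‖v x‖ₑ = g x)
    (hhv : ∀ x ∈ Ω, ‖fderiv ℝ v x‖ₑ = h x)
    {l : ℝ} (hl : 0 ≤ l) (hl' : l ≤ 1) {x : E} (hx : x ∈ Ω) :
    ‖v x‖ₑ ≤ contractionMean μ Ω (l ^ 2) g x + ENNReal.ofReal (2 * D) *
      ∫⁻ τ in Ioc 0 l, ENNReal.ofReal τ * contractionMean μ Ω (τ ^ 2) h x := by
  have hmem : ∀ y ∈ Ω, ∀ τ ∈ Icc 0 l, (1 - τ ^ 2) • x + τ ^ 2 • y ∈ Ω := fun y hy τ hτ => by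
    have h1 : τ ^ 2 ≤ 1 := pow_le_one₀ hτ.1 (hτ.2.trans hl')
    exact hconv hx hy (by linarith) (by positivity) (by ring)
  have hpt : ∀ y ∈ Ω, ‖v x‖ₑ ≤ g ((1 - l ^ 2) • x + l ^ 2 • y) + ENNReal.ofReal (2 * D) *
      ∫⁻ τ in Ioc 0 l, ENNReal.ofReal τ * h ((1 - τ ^ 2) • x + τ ^ 2 • y) := fun y hy => by
    refine (enorm_le_enorm_add_lintegral_fderiv hΩ hconv hv hx hy (hD x hx y hy) hl hl').trans_eq ?_
    rw [hgv _ (hmem y hy l ⟨hl, le_rfl⟩)]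
    congr 2
    refine setLIntegral_congr_fun measurableSet_Ioc fun τ hτ => ?_
    rw [hhv _ (hmem y hy τ ⟨hτ.1.le, hτ.2⟩)]
  have hint := setLIntegral_mono_ae' (μ := μ) hΩ.measurableSet (Filter.Eventually.of_forall hpt)
  rw [setLIntegral_const, lintegral_add_left (by fun_prop),
    lintegral_const_mul' _ _ ENNReal.ofReal_ne_top,
    lintegral_lintegral_swap (by fun_prop)] at hint
  have hmean : (μ Ω)⁻¹ * ∫⁻ τ in Ioc 0 l, ∫⁻ y in Ω,
        ENNReal.ofReal τ * h ((1 - τ ^ 2) • x + τ ^ 2 • y) ∂μ =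
      ∫⁻ τ in Ioc 0 l, ENNReal.ofReal τ * contractionMean μ Ω (τ ^ 2) h x := by
    rw [← lintegral_const_mul' _ _ (ENNReal.inv_ne_top.2 h0)]
    refine lintegral_congr fun τ => ?_
    rw [contractionMean, lintegral_const_mul' _ _ ENNReal.ofReal_ne_top]
    ring
  calc ‖v x‖ₑ = (μ Ω)⁻¹ * (‖v x‖ₑ * μ Ω) := by
        rw [mul_comm ‖v x‖ₑ, ← mul_assoc, ENNReal.inv_mul_cancel h0 h1, one_mul]
    _ ≤ _ := mul_le_mul_right hint _
    _ = _ := by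
        rw [← hmean, mul_add, contractionMean]
        ring

/-- Integrating the `L² → L³` bounds in `τ`: the weight `τ` in the oscillation exactly cancels
the growth of the contraction mean. -/
theorem lintegral_oscillation_pow_three_le (hE : Module.finrank ℝ E ≤ 3) {S : Set E}
    (h0 : μ S ≠ 0) (h1 : μ S ≠ ⊤) {h : E → ℝ≥0∞} (hh : Measurable h)
    {l : ℝ} (hl : 0 ≤ l) (hl' : l ≤ 1 / 2) :
    ∫⁻ x, (∫⁻ τ in Ioc 0 l, ENNReal.ofReal τ * contractionMean μ S (τ ^ 2) h x) ^ 3 ∂μ ≤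
      ENNReal.ofReal (l ^ 3) *
        (8 * (μ S)⁻¹ ^ (1 / 2 : ℝ) * (∫⁻ x, h x ^ 2 ∂μ) ^ (3 / 2 : ℝ)) := by
  set R := 8 * (μ S)⁻¹ ^ (1 / 2 : ℝ) * (∫⁻ x, h x ^ 2 ∂μ) ^ (3 / 2 : ℝ) with hR
  have hTm : Measurable fun q : ℝ × E => contractionMean μ S (q.1 ^ 2) h q.2 :=
    (measurable_contractionMean μ hh).comp
      (by fun_prop : Measurable fun q : ℝ × E => (q.1 ^ 2, q.2))
  have hslice : ∀ τ ∈ Ioc 0 l,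
      ∫⁻ x, (ENNReal.ofReal τ * contractionMean μ S (τ ^ 2) h x) ^ 3 ∂μ ≤ R := by
    intro τ hτ
    have hτ0 : 0 < τ := hτ.1
    simp_rw [mul_pow]
    rw [lintegral_const_mul' _ _ (ENNReal.pow_ne_top ENNReal.ofReal_ne_top)]
    have hb := lintegral_contractionMean_pow_three_le μ hE h0 h1 hh hτ0 (hτ.2.trans hl')
    refine (mul_le_mul_right hb _).trans_eq ?_
    have hc : ENNReal.ofReal τ ^ 3 * ENNReal.ofReal ((τ ^ 3)⁻¹) = 1 := by
      rw [← ENNReal.ofReal_pow hτ0.le, ← ENNReal.ofReal_mul (by positivity),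
        mul_inv_cancel₀ (by positivity), ENNReal.ofReal_one]
    calc _ = (ENNReal.ofReal τ ^ 3 * ENNReal.ofReal ((τ ^ 3)⁻¹)) * R := by rw [hR]; ring
      _ = R := by rw [hc, one_mul]
  have hholder : ∀ x,
      (∫⁻ τ in Ioc 0 l, ENNReal.ofReal τ * contractionMean μ S (τ ^ 2) h x) ^ 3 ≤
        ENNReal.ofReal l ^ 2 * ∫⁻ τ in Ioc 0 l,
          (ENNReal.ofReal τ * contractionMean μ S (τ ^ 2) h x) ^ 3 := fun x => by
    have := pow_lintegral_le (volume.restrict (Ioc 0 l))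
      (f := fun τ => ENNReal.ofReal τ * contractionMean μ S (τ ^ 2) h x)
      (ENNReal.measurable_ofReal.mul
        (hTm.comp (measurable_id.prodMk measurable_const))).aemeasurable two_ne_zero
    rwa [Measure.restrict_apply_univ, Real.volume_Ioc, sub_zero] at this
  have hmeas : Measurable fun q : E × ℝ =>
      (ENNReal.ofReal q.2 * contractionMean μ S (q.2 ^ 2) h q.1) ^ 3 :=
    ((ENNReal.measurable_ofReal.comp measurable_snd).mul (hTm.comp measurable_swap)).pow_const 3
  refine (lintegral_mono hholder).trans ?_
  rw [lintegral_const_mul' _ _ (ENNReal.pow_ne_top ENNReal.ofReal_ne_top),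
    lintegral_lintegral_swap hmeas.aemeasurable]
  have hint := setLIntegral_mono_ae' (μ := volume) measurableSet_Ioc
    (Filter.Eventually.of_forall hslice)
  rw [setLIntegral_const, Real.volume_Ioc, sub_zero] at hint
  refine (mul_le_mul_right hint _).trans_eq ?_
  rw [ENNReal.ofReal_pow hl]
  ring

/-- The scale-dependent interpolation inequality: `‖v‖₃³` is controlled by the mean of `v` over
copies of `Ω` contracted by `l²`, plus the oscillation of `v` on that scale. -/
theorem lintegral_enorm_pow_three_le (hE : Module.finrank ℝ E ≤ 3) {Ω : Set E} (hΩ : IsOpen Ω)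
    (hconv : Convex ℝ Ω) (h0 : μ Ω ≠ 0) (h1 : μ Ω ≠ ⊤)
    {v : E → F} (hv : ContDiffOn ℝ 1 v Ω) {D : ℝ} (hD : ∀ x ∈ Ω, ∀ y ∈ Ω, ‖y - x‖ ≤ D)
    {l : ℝ} (hl : 0 < l) (hl' : l ≤ 1 / 2) :
    ∫⁻ x in Ω, ‖v x‖ₑ ^ 3 ∂μ ≤ 32 * (μ Ω)⁻¹ ^ (1 / 2 : ℝ) *
      (ENNReal.ofReal ((l ^ 3)⁻¹) * (∫⁻ x in Ω, ‖v x‖ₑ ^ 2 ∂μ) ^ (3 / 2 : ℝ) +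
        ENNReal.ofReal (2 * D) ^ 3 * (ENNReal.ofReal (l ^ 3) *
          (∫⁻ x in Ω, ‖fderiv ℝ v x‖ₑ ^ 2 ∂μ) ^ (3 / 2 : ℝ))) := by
  classical
  have hm := hΩ.measurableSet
  set g : E → ℝ≥0∞ := Ω.indicator fun x => ‖v x‖ₑ with hg_def
  set h : E → ℝ≥0∞ := Ω.indicator fun x => ‖fderiv ℝ v x‖ₑ with hh_def
  have hg : Measurable g := by
    rw [hg_def, ← piecewise_eq_indicator]
    exact hv.continuousOn.enorm.measurable_piecewise continuousOn_const hm
  have hh : Measurable h := by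
    rw [hh_def, ← piecewise_eq_indicator]
    exact (hv.continuousOn_fderiv_of_isOpen hΩ le_rfl).enorm.measurable_piecewise
      continuousOn_const hm
  have hgI : ∫⁻ x, g x ^ 2 ∂μ = ∫⁻ x in Ω, ‖v x‖ₑ ^ 2 ∂μ := by
    rw [← lintegral_indicator hm]
    refine lintegral_congr fun x => ?_
    by_cases hx : x ∈ Ω <;> simp [hg_def, hx]
  have hhI : ∫⁻ x, h x ^ 2 ∂μ = ∫⁻ x in Ω, ‖fderiv ℝ v x‖ₑ ^ 2 ∂μ := by
    rw [← lintegral_indicator hm]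
    refine lintegral_congr fun x => ?_
    by_cases hx : x ∈ Ω <;> simp [hh_def, hx]
  set K := 8 * (μ Ω)⁻¹ ^ (1 / 2 : ℝ) with hK
  set A := (∫⁻ x in Ω, ‖v x‖ₑ ^ 2 ∂μ) ^ (3 / 2 : ℝ)
  set B := (∫⁻ x in Ω, ‖fderiv ℝ v x‖ₑ ^ 2 ∂μ) ^ (3 / 2 : ℝ)
  have hTg : Measurable fun x => contractionMean μ Ω (l ^ 2) g x :=
    (measurable_contractionMean μ hg).comp (measurable_const.prodMk measurable_id)
  have hosc := lintegral_oscillation_pow_three_le μ hE h0 h1 hh hl.le hl'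
  have hmean := lintegral_contractionMean_pow_three_le μ hE h0 h1 hg hl hl'
  rw [hhI] at hosc
  rw [hgI] at hmean
  calc ∫⁻ x in Ω, ‖v x‖ₑ ^ 3 ∂μ
      ≤ ∫⁻ x in Ω, 4 * (contractionMean μ Ω (l ^ 2) g x ^ 3 + ENNReal.ofReal (2 * D) ^ 3 *
          (∫⁻ τ in Ioc 0 l, ENNReal.ofReal τ * contractionMean μ Ω (τ ^ 2) h x) ^ 3) ∂μ := by
        refine setLIntegral_mono_ae' hm (Filter.Eventually.of_forall fun x hx => ?_)
        have := enorm_le_contractionMean_add μ hΩ hconv h0 h1 hv hD hg hh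
          (fun x hx => by simp [hg_def, hx]) (fun x hx => by simp [hh_def, hx])
          hl.le (by linarith) hx
        refine (pow_le_pow_left' this 3).trans ?_
        rw [← mul_pow]
        have hcube := ENNReal.rpow_add_le_mul_rpow_add_rpow (contractionMean μ Ω (l ^ 2) g x)
          (ENNReal.ofReal (2 * D) *
            ∫⁻ τ in Ioc 0 l, ENNReal.ofReal τ * contractionMean μ Ω (τ ^ 2) h x)
          (p := ((3 : ℕ) : ℝ)) (by norm_num)
        rw [show (2 : ℝ≥0∞) ^ (((3 : ℕ) : ℝ) - 1) = 4 by
          rw [show ((3 : ℕ) : ℝ) - 1 = ((2 : ℕ) : ℝ) by norm_num, ENNReal.rpow_natCast]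
          norm_num] at hcube
        simpa only [ENNReal.rpow_natCast] using hcube
    _ ≤ ∫⁻ x, 4 * (contractionMean μ Ω (l ^ 2) g x ^ 3 + ENNReal.ofReal (2 * D) ^ 3 *
          (∫⁻ τ in Ioc 0 l, ENNReal.ofReal τ * contractionMean μ Ω (τ ^ 2) h x) ^ 3) ∂μ :=
        setLIntegral_le_lintegral _ _
    _ = 4 * (∫⁻ x, contractionMean μ Ω (l ^ 2) g x ^ 3 ∂μ + ENNReal.ofReal (2 * D) ^ 3 *
          ∫⁻ x, (∫⁻ τ in Ioc 0 l, ENNReal.ofReal τ * contractionMean μ Ω (τ ^ 2) h x) ^ 3 ∂μ) := by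
        rw [lintegral_const_mul' _ _ (by finiteness), lintegral_add_left (by fun_prop),
          lintegral_const_mul' _ _ (by finiteness)]
    _ ≤ 4 * (K * ENNReal.ofReal ((l ^ 3)⁻¹) * A +
          ENNReal.ofReal (2 * D) ^ 3 * (ENNReal.ofReal (l ^ 3) * (K * B))) := by
        gcongr
    _ = _ := by rw [hK]; ring

end ConvexDomain

/-! ### Choice of the length scale -/

/-- Optimization over the length scale `l`: the choice `l = F^(-1/6) / 2` makes `l³ F^(3/2)`
proportional to `F`, and is admissible when `1 ≤ F`; otherwise `l = 1 / 2` suffices. -/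
theorem le_of_forall_scale {X A B E F : ℝ≥0∞} (hA : A ≠ 0)
    (h : ∀ l : ℝ, 0 < l → l ≤ 1 / 2 →
      X ≤ A * (ENNReal.ofReal ((l ^ 3)⁻¹) * E ^ (3 / 2 : ℝ) +
        B * (ENNReal.ofReal (l ^ 3) * F ^ (3 / 2 : ℝ)))) :
    X ≤ A * (8 + B) * (F + E ^ 3 + E ^ (3 / 2 : ℝ)) := by
  have h8 : ENNReal.ofReal (((1 / 2 : ℝ) ^ 3)⁻¹) = 8 := by norm_num
  rcases eq_or_ne F ⊤ with rfl | hF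
  · simp [hA, ENNReal.mul_top]
  rw [mul_assoc]
  rcases lt_or_ge F 1 with hF1 | hF1
  · refine (h (1 / 2) (by norm_num) le_rfl).trans ?_
    gcongr
    rw [h8]
    have h18 : ENNReal.ofReal ((1 / 2 : ℝ) ^ 3) ≤ 1 := by
      rw [← ENNReal.ofReal_one]; exact ENNReal.ofReal_le_ofReal (by norm_num)
    have hF32 : F ^ (3 / 2 : ℝ) ≤ F := by
      simpa using ENNReal.rpow_le_rpow_of_exponent_ge hF1.le (by norm_num : (1 : ℝ) ≤ 3 / 2)
    calc _ ≤ 8 * E ^ (3 / 2 : ℝ) + B * (1 * F) := by gcongr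
      _ ≤ 8 * (F + E ^ 3 + E ^ (3 / 2 : ℝ)) + B * (F + E ^ 3 + E ^ (3 / 2 : ℝ)) := by
        gcongr
        · exact le_add_self
        · rw [one_mul, add_assoc]; exact le_self_add
      _ = _ := by ring
  · lift F to NNReal using hF
    have hf1 : (1 : ℝ) ≤ F := by exact_mod_cast hF1
    have hf0 : (0 : ℝ) < F := by linarith
    set f : ℝ := (F : ℝ)
    have hFf : (F : ℝ≥0∞) = ENNReal.ofReal f := by simp [f]
    set l : ℝ := f ^ (-(1 / 6) : ℝ) / 2 with hl
    have hl3 : l ^ 3 = f ^ (-(1 / 2) : ℝ) / 8 := by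
      rw [hl, div_pow, ← Real.rpow_natCast, ← Real.rpow_mul hf0.le]
      norm_num
    have hl3i : (l ^ 3)⁻¹ = 8 * f ^ (1 / 2 : ℝ) := by
      rw [hl3, inv_div, Real.rpow_neg hf0.le, div_inv_eq_mul]
    refine (h l (by positivity) ?_).trans ?_
    · have : f ^ (-(1 / 6) : ℝ) ≤ 1 := Real.rpow_le_one_of_one_le_of_nonpos hf1 (by norm_num)
      rw [hl]; linarith
    gcongr
    have e1 : ENNReal.ofReal ((l ^ 3)⁻¹) = 8 * (F : ℝ≥0∞) ^ (1 / 2 : ℝ) := by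
      rw [hl3i, ENNReal.ofReal_mul (by norm_num), hFf,
        ENNReal.ofReal_rpow_of_nonneg hf0.le (by norm_num)]
      norm_num
    have e2 : ENNReal.ofReal (l ^ 3) * (F : ℝ≥0∞) ^ (3 / 2 : ℝ) ≤ F := by
      rw [hFf, ENNReal.ofReal_rpow_of_nonneg hf0.le (by norm_num),
        ← ENNReal.ofReal_mul (by positivity)]
      apply ENNReal.ofReal_le_ofReal
      rw [hl3, div_mul_eq_mul_div, ← Real.rpow_add hf0]
      norm_num
      linarith
    have e3 : (F : ℝ≥0∞) ^ (1 / 2 : ℝ) * E ^ (3 / 2 : ℝ) ≤ F + E ^ 3 := by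
      have hsq : ∀ a b : ℝ≥0∞, a * b ≤ a ^ 2 + b ^ 2 := fun a b => by
        rcases le_total a b with hab | hab
        · exact (mul_le_mul_left hab b).trans (by rw [sq b]; exact le_add_self)
        · exact (mul_le_mul_right hab a).trans (by rw [sq a]; exact le_self_add)
      refine (hsq _ _).trans_eq ?_
      simp only [← ENNReal.rpow_natCast, ← ENNReal.rpow_mul]
      norm_num
    calc _ ≤ 8 * (F : ℝ≥0∞) ^ (1 / 2 : ℝ) * E ^ (3 / 2 : ℝ) + B * F := by
          rw [e1]; gcongr
      _ = 8 * ((F : ℝ≥0∞) ^ (1 / 2 : ℝ) * E ^ (3 / 2 : ℝ)) + B * F := by ring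
      _ ≤ 8 * (F + E ^ 3 + E ^ (3 / 2 : ℝ)) + B * (F + E ^ 3 + E ^ (3 / 2 : ℝ)) := by
        gcongr
        · exact e3.trans le_self_add
        · rw [add_assoc]; exact le_self_add
      _ = _ := by ring

/-! ### Weighted integrals -/

/-- The operator norm is bounded by the Hilbert–Schmidt norm. -/
theorem sq_norm_fderiv_le_gradNormSq {n : ℕ}
    (v : EuclideanSpace ℝ (Fin n) → EuclideanSpace ℝ (Fin n)) (x : EuclideanSpace ℝ (Fin n)) :
    ‖fderiv ℝ v x‖ ^ 2 ≤ gradNormSq v x := by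
  have hnn : 0 ≤ gradNormSq v x :=
    Finset.sum_nonneg fun i _ => Finset.sum_nonneg fun j _ => sq_nonneg _
  set A := fderiv ℝ v x with hA
  suffices h : ‖A‖ ≤ √(gradNormSq v x) by
    simpa [Real.sq_sqrt hnn] using pow_le_pow_left₀ (norm_nonneg _) h 2
  refine A.opNorm_le_bound (Real.sqrt_nonneg _) fun w => ?_
  refine le_of_sq_le_sq ?_ (by positivity)
  rw [mul_pow, Real.sq_sqrt hnn, EuclideanSpace.real_norm_sq_eq, EuclideanSpace.real_norm_sq_eq,
    gradNormSq, Finset.sum_mul]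
  refine Finset.sum_le_sum fun i _ => ?_
  have hw : A w i = ∑ j, A (EuclideanSpace.single j 1) i * w j := by
    conv_lhs => rw [← (EuclideanSpace.basisFun (Fin n) ℝ).sum_repr w]
    simp [mul_comm]
  rw [hw]
  exact Finset.sum_mul_sq_le_sq_mul_sq _ _ _

theorem enorm_fderiv_sq_le {n : ℕ}
    (v : EuclideanSpace ℝ (Fin n) → EuclideanSpace ℝ (Fin n)) (x : EuclideanSpace ℝ (Fin n)) :
    ‖fderiv ℝ v x‖ₑ ^ 2 ≤ ENNReal.ofReal (gradNormSq v x) := by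
  rw [← ofReal_norm, ← ENNReal.ofReal_pow (norm_nonneg _)]
  exact ENNReal.ofReal_le_ofReal (sq_norm_fderiv_le_gradNormSq v x)

/-- Bounds valid for positive times extend to `t = 0`, since `ρ` is continuous up to `t = 0`. -/
theorem bounds_of_bounds_pos_time {n : ℕ} {Ω : Set (EuclideanSpace ℝ (Fin n))} {α : ℝ}
    {d φ ρ₀ : EuclideanSpace ℝ (Fin n) → ℝ} {ρ : ℝ → EuclideanSpace ℝ (Fin n) → ℝ}
    (hρ : IsClassicalSolution Ω α d φ ρ₀ ρ) {c C : ℝ}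
    (hb : ∀ t, 0 < t → ∀ x ∈ closure Ω, c ≤ ρ t x ∧ ρ t x ≤ C) :
    ∀ t, 0 ≤ t → ∀ x ∈ closure Ω, c ≤ ρ t x ∧ ρ t x ≤ C := by
  intro t ht x hx
  rcases ht.eq_or_lt with rfl | ht
  · have hc : ContinuousOn (fun s => ρ s x) (Ici 0) :=
      hρ.continuousOn.comp (f := fun s : ℝ => (s, x)) (by fun_prop) fun s hs => ⟨hs, hx⟩
    have hlim : Filter.Tendsto (fun s => ρ s x) (nhdsWithin 0 (Ioi 0)) (nhds (ρ 0 x)) :=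
      (hc 0 self_mem_Ici).mono_left (nhdsWithin_mono _ Ioi_subset_Ici_self)
    exact isClosed_Icc.mem_of_tendsto hlim
      (eventually_nhdsWithin_of_forall fun s hs => hb s hs x hx)
  · exact hb t ht x hx

theorem lintegral_mul_weight_le {n : ℕ} {Ω : Set (EuclideanSpace ℝ (Fin n))}
    (hΩ : MeasurableSet Ω) {f r : EuclideanSpace ℝ (Fin n) → ℝ} (hf : ∀ x, 0 ≤ f x) {C : ℝ}
    (hC : 0 ≤ C) (hr : ∀ x ∈ Ω, r x ≤ C) :
    ∫⁻ x in Ω, ENNReal.ofReal (f x * r x) ≤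
      ENNReal.ofReal C * ∫⁻ x in Ω, ENNReal.ofReal (f x) := by
  rw [← lintegral_const_mul' _ _ ENNReal.ofReal_ne_top]
  refine setLIntegral_mono_ae' hΩ (Filter.Eventually.of_forall fun x hx => ?_)
  rw [← ENNReal.ofReal_mul hC, mul_comm]
  exact ENNReal.ofReal_le_ofReal (mul_le_mul_of_nonneg_right (hr x hx) (hf x))

theorem lintegral_le_mul_weight {n : ℕ} {Ω : Set (EuclideanSpace ℝ (Fin n))}
    (hΩ : MeasurableSet Ω) {f r : EuclideanSpace ℝ (Fin n) → ℝ} (hf : ∀ x, 0 ≤ f x) {c : ℝ}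
    (hc : 0 < c) (hr : ∀ x ∈ Ω, c ≤ r x) :
    ∫⁻ x in Ω, ENNReal.ofReal (f x) ≤
      ENNReal.ofReal c⁻¹ * ∫⁻ x in Ω, ENNReal.ofReal (f x * r x) := by
  rw [← lintegral_const_mul' _ _ ENNReal.ofReal_ne_top]
  refine setLIntegral_mono_ae' hΩ (Filter.Eventually.of_forall fun x hx => ?_)
  rw [← ENNReal.ofReal_mul (inv_nonneg.2 hc.le)]
  apply ENNReal.ofReal_le_ofReal
  rw [inv_mul_eq_div, le_div_iff₀ hc]
  exact mul_le_mul_of_nonneg_left (hr x hx) (hf x)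

/-- The unweighted inequality, with one constant depending only on the volume and the diameter of
the domain. -/
theorem exists_lintegral_norm_pow_three_le {n : ℕ} (hn : n ≤ 3)
    {Ω : Set (EuclideanSpace ℝ (Fin n))} (hΩ : IsOpen Ω) (hne : Ω.Nonempty)
    (hbdd : Bornology.IsBounded Ω) (hconv : Convex ℝ Ω) :
    ∃ K : ℝ, 0 < K ∧
      ∀ v : EuclideanSpace ℝ (Fin n) → EuclideanSpace ℝ (Fin n), ContDiffOn ℝ 1 v Ω →
        ∫⁻ x in Ω, ENNReal.ofReal (‖v x‖ ^ 3) ≤ ENNReal.ofReal K *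
          ((∫⁻ x in Ω, ENNReal.ofReal (gradNormSq v x)) +
            (∫⁻ x in Ω, ENNReal.ofReal (‖v x‖ ^ 2)) ^ 3 +
            (∫⁻ x in Ω, ENNReal.ofReal (‖v x‖ ^ 2)) ^ (3 / 2 : ℝ)) := by
  have h0 : volume Ω ≠ 0 := (hΩ.measure_pos volume hne).ne'
  have h1 : volume Ω ≠ ⊤ := hbdd.measure_lt_top.ne
  have hD : ∀ x ∈ Ω, ∀ y ∈ Ω, ‖y - x‖ ≤ Metric.diam Ω := fun x hx y hy => by
    rw [← dist_eq_norm]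
    exact Metric.dist_le_diam_of_mem hbdd hy hx
  set A : ℝ≥0∞ := 32 * (volume Ω)⁻¹ ^ (1 / 2 : ℝ) with hA
  set B : ℝ≥0∞ := ENNReal.ofReal (2 * Metric.diam Ω) ^ 3 with hB
  have hA0 : A ≠ 0 :=
    mul_ne_zero (by norm_num) (by simp [ENNReal.rpow_eq_zero_iff, h1])
  have hAt : A ≠ ⊤ := ENNReal.mul_ne_top (by norm_num)
    (ENNReal.rpow_ne_top_of_nonneg (by norm_num) (ENNReal.inv_ne_top.2 h0))
  have hBt : 8 + B ≠ ⊤ :=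
    ENNReal.add_ne_top.2 ⟨by norm_num, ENNReal.pow_ne_top ENNReal.ofReal_ne_top⟩
  have hKt : A * (8 + B) ≠ ⊤ := ENNReal.mul_ne_top hAt hBt
  refine ⟨(A * (8 + B)).toReal, ENNReal.toReal_pos (mul_ne_zero hA0 (by simp)) hKt, ?_⟩
  intro v hv
  rw [ENNReal.ofReal_toReal hKt]
  have hpow : ∀ (x : EuclideanSpace ℝ (Fin n)) (k : ℕ),
      ENNReal.ofReal (‖v x‖ ^ k) = ‖v x‖ₑ ^ k := fun x k => by
    rw [ENNReal.ofReal_pow (norm_nonneg _), ofReal_norm]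
  simp_rw [hpow]
  refine (le_of_forall_scale (B := B) hA0 fun l hl hl' =>
    lintegral_enorm_pow_three_le volume (by simpa using hn) hΩ hconv h0 h1 hv hD hl hl').trans ?_
  gcongr with x
  exact enorm_fderiv_sq_le v x

theorem mainTheorem3 (n : ℕ) (hn : n = 1 ∨ n = 2 ∨ n = 3)
    (Ω : Set (EuclideanSpace ℝ (Fin n))) (hΩ : IsSmoothBoundedConvexDomain Ω)
    (c C : ℝ) (hc : 0 < c) (hC : 0 < C) :
    ∃ C₁ C₂ C₃ : ℝ, 0 < C₁ ∧ 0 < C₂ ∧ 0 < C₃ ∧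
      ∀ (α Dmin : ℝ) (d φ ρ₀ : EuclideanSpace ℝ (Fin n) → ℝ)
        (ρ : ℝ → EuclideanSpace ℝ (Fin n) → ℝ),
        IsNFPData Ω α Dmin d φ ρ₀ →
        IsClassicalSolution Ω α d φ ρ₀ ρ →
        (∀ t, 0 < t → ∀ x ∈ closure Ω, c ≤ ρ t x ∧ ρ t x ≤ C) →
        ∀ t, 0 ≤ t →
        ∀ v : EuclideanSpace ℝ (Fin n) → EuclideanSpace ℝ (Fin n), ContDiffOn ℝ 1 v Ω →
          ∫⁻ x in Ω, ENNReal.ofReal (‖v x‖ ^ 3 * ρ t x) ≤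
            ENNReal.ofReal C₁ * (∫⁻ x in Ω, ENNReal.ofReal (gradNormSq v x * ρ t x)) +
            ENNReal.ofReal C₂ * (∫⁻ x in Ω, ENNReal.ofReal (‖v x‖ ^ 2 * ρ t x)) ^ 3 +
            ENNReal.ofReal C₃ * (∫⁻ x in Ω, ENNReal.ofReal (‖v x‖ ^ 2 * ρ t x)) ^ (3 / 2 : ℝ) := by
  obtain ⟨K, hK, h⟩ := exists_lintegral_norm_pow_three_le (by omega) hΩ.isOpen hΩ.nonempty
    hΩ.isBounded hΩ.convex
  refine ⟨C * K * c⁻¹, C * K * c⁻¹ ^ 3, C * K * c⁻¹ ^ (3 / 2 : ℝ), by positivity, by positivity,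
    by positivity, ?_⟩
  intro α Dmin d φ ρ₀ ρ _ hρ hb t ht v hv
  have hbt := bounds_of_bounds_pos_time hρ hb t ht
  have hm := hΩ.isOpen.measurableSet
  have hlow : ∀ x ∈ Ω, c ≤ ρ t x := fun x hx => (hbt x (subset_closure hx)).1
  have hup : ∀ x ∈ Ω, ρ t x ≤ C := fun x hx => (hbt x (subset_closure hx)).2
  have hG := lintegral_le_mul_weight hm (f := gradNormSq v)
    (fun x => (sq_nonneg _).trans (sq_norm_fderiv_le_gradNormSq v x)) hc hlow
  have hE := lintegral_le_mul_weight hm (f := fun x => ‖v x‖ ^ 2) (fun x => by positivity) hc hlow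
  have hL := lintegral_mul_weight_le hm (f := fun x => ‖v x‖ ^ 3) (fun x => by positivity) hC.le hup
  set G' := ∫⁻ x in Ω, ENNReal.ofReal (gradNormSq v x * ρ t x)
  set E' := ∫⁻ x in Ω, ENNReal.ofReal (‖v x‖ ^ 2 * ρ t x)
  calc _ ≤ ENNReal.ofReal C * (ENNReal.ofReal K * (ENNReal.ofReal c⁻¹ * G' +
        (ENNReal.ofReal c⁻¹ * E') ^ 3 + (ENNReal.ofReal c⁻¹ * E') ^ (3 / 2 : ℝ))) := by
        refine hL.trans (mul_le_mul_right ((h v hv).trans ?_) _)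
        gcongr
    _ = _ := by
        have hc' : 0 ≤ c⁻¹ := inv_nonneg.2 hc.le
        have hsplit : ∀ a : ℝ, ENNReal.ofReal (C * K * a) =
            ENNReal.ofReal C * ENNReal.ofReal K * ENNReal.ofReal a := fun a => by
          rw [ENNReal.ofReal_mul (by positivity), ENNReal.ofReal_mul hC.le]
        rw [ENNReal.mul_rpow_of_nonneg _ _ (by norm_num), mul_pow,
          ENNReal.ofReal_rpow_of_nonneg hc' (by norm_num), ← ENNReal.ofReal_pow hc',
          hsplit, hsplit, hsplit]
        ring
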